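/- **Theorem 1.** For $h\ge 1$ let $[h]=1+q+\cdots+q^{h-1}$ and, for a variable $u$, $[h]_u=1+q+\cdots+q^{h-2}+u\,q^{h-1}$; for $h\ge 2$ let $[h]_{x,y}=1+q+\cdots+q^{h-3}+(x+y-xy)q^{h-2}+xy\,q^{h-1}$. Let $F(q,x,y,z)$ be the formal power series in $z$ given by the continued fraction $$F(q,x,y,z)=\cfrac{1}{1-z([1]_x+[1]_y)-\cfrac{z^2[1]\,[2]_{x,y}}{1-z([2]_x+[2]_y)-\cfrac{z^2[2]\,[3]_{x,y}}{1-z([3]_x+[3]_y)-\cdots}}}\,.$$ The standard cycle form of a permutation $\pi$ of $\{1,\dots,n\}$ writes each cycle (fixed points included) as a word $c, \pi(c), \pi^2(c),\dots$ starting with its smallest element $c$, and lists the cycles in decreasing order of their smallest elements. A cyclic occurrence of 2--13 in $\pi$ is either an occurrence *between cycles*: a letter $b$ of one cycle and two adjacent letters $a,c$ (in this order) of the word of a cycle listed later, with $a<b<c$; or an occurrence *within a cycle*: a letter $b$ and two adjacent letters $a,c$ (in this order) to the right of $b$ in the word of the same cycle, with $a<b<c$. Let $\Phi_{i,j}(n)$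 be the number of permutations of $\{1,\dots,n\}$ with exactly $i$ cyclic occurrences of 2--13 and exactly $j$ cycles. Then for all integers $i,j,n\ge 0$, $$\Phi_{i,j+1}(n+1)=[q^i x^j z^n]\,F(q,x,1,z),$$ and $\Phi_{i,0}(n+1)=0$. -/

import Mathlib

namespace CyclicPattern

/-! ### The continued fraction -/

section ContinuedFraction

open PowerSeries

variable {R : Type*} [CommRing R]

/-- `[h] = 1 + q + ⋯ + q^(h-1)`. -/
def qNum (q : R) (h : ℕ) : R := ∑ i ∈ Finset.range h, q ^ i

/-- `[h]_x = 1 + q + ⋯ + q^(h-2) + x q^(h-1)`; used for `h ≥ 1` only. -/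
def qNumOne (q x : R) (h : ℕ) : R := ∑ i ∈ Finset.range (h - 1), q ^ i + x * q ^ (h - 1)

/-- `[h]_{x,y} = 1 + q + ⋯ + q^(h-3) + (x + y - x y) q^(h-2) + x y q^(h-1)`;
used for `h ≥ 2` only. -/
def qNumTwo (q x y : R) (h : ℕ) : R :=
  ∑ i ∈ Finset.range (h - 2), q ^ i + (x + y - x * y) * q ^ (h - 2) + x * y * q ^ (h - 1)

/-- The continued fraction started at level `h` and cut off after `N` levels
(the remaining tail is replaced by `1`), a formal power series in `t` over `R`:
`1 / (1 - t ([h]_x + [h]_y) - t² [h] [h+1]_{x,y} * (same at level h + 1, N - 1 levels))`.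
The denominator has constant coefficient `1`, so `invOfUnit _ 1` is its inverse. -/
noncomputable def convergent (q x y : R) : ℕ → ℕ → R⟦X⟧
  | 0, _ => 1
  | N + 1, h =>
      invOfUnit
        (1 - X * C (qNumOne q x h + qNumOne q y h)
          - X ^ 2 * C (qNum q h * qNumTwo q x y (h + 1)) * convergent q x y N (h + 1)) 1

/-- The infinite continued fraction `F(q,x,y,t)`, a formal power series in `t`: the coefficient of
`t^n` is the one of the convergents with at least `n` levels (see `coeff_convergent`). -/
noncomputable def F (q x y : R) : R⟦X⟧ :=
  PowerSeries.mk fun n => coeff n (convergent q x y n 1)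

theorem convergent_mul_denominator (q x y : R) (N h : ℕ) :
    convergent q x y (N + 1) h *
      (1 - X * C (qNumOne q x h + qNumOne q y h)
          - X ^ 2 * C (qNum q h * qNumTwo q x y (h + 1)) * convergent q x y N (h + 1)) = 1 := by
  rw [convergent]
  exact invOfUnit_mul _ _ (by simp)

theorem X_pow_dvd_convergent_sub (q x y : R) (M N h : ℕ) (hMN : M ≤ N) :
    (X : R⟦X⟧) ^ (M + 1) ∣ convergent q x y N h - convergent q x y M h := by
  induction M generalizing N h with
  | zero =>
    rw [zero_add, pow_one, X_dvd_iff]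
    cases N with
    | zero => simp
    | succ N => simp [convergent]
  | succ M ih =>
    obtain ⟨N, rfl⟩ : ∃ k, N = k + 1 := ⟨N - 1, by omega⟩
    obtain ⟨c, hc⟩ := ih N (h + 1) (by omega)
    have h1 := convergent_mul_denominator q x y N h
    have h2 := convergent_mul_denominator q x y M h
    refine ⟨convergent q x y (N + 1) h * convergent q x y (M + 1) h * X
      * C (qNum q h * qNumTwo q x y (h + 1)) * c, ?_⟩
    linear_combination convergent q x y (M + 1) h * h1 - convergent q x y (N + 1) h * h2
      + convergent q x y (N + 1) h * convergent q x y (M + 1) h * X ^ 2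
      * C (qNum q h * qNumTwo q x y (h + 1)) * hc

/-- The convergents converge coefficientwise to `F`. -/
theorem coeff_convergent (q x y : R) (n N : ℕ) (h : n ≤ N) :
    coeff n (convergent q x y N 1) = coeff n (F q x y) := by
  have := (X_pow_dvd_iff.1 (X_pow_dvd_convergent_sub q x y n N 1 h)) n (Nat.lt_succ_self n)
  rw [map_sub, sub_eq_zero] at this
  rw [this, F, coeff_mk]

end ContinuedFraction

/-! ### Standard cycle form and cyclic occurrences of 2--13 -/

section Permutations

variable {n : ℕ}

/-- The minimal elements of the cycles of `π` (fixed points are cycles of length one). -/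
def cycleMins (π : Equiv.Perm (Fin n)) : Finset (Fin n) :=
  {m | ∀ k, π.SameCycle m k → m ≤ k}

/-- The cycle of `π` through `m`, written as the word `m, π m, π² m, …`. -/
noncomputable def cycleWord (π : Equiv.Perm (Fin n)) (m : Fin n) : List (Fin n) :=
  List.iterate π m (Function.minimalPeriod π m)

/-- The standard cycle form: each cycle is written starting with its smallest element, and the
cycles are listed in decreasing order of their smallest elements. -/
noncomputable def standardCycleForm (π : Equiv.Perm (Fin n)) : List (List (Fin n)) :=
  ((cycleMins π).sort (· ≥ ·)).map (cycleWord π)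

/-- The number of cycles of `π`, fixed points included. -/
noncomputable def numCycles (π : Equiv.Perm (Fin n)) : ℕ := (standardCycleForm π).length

/-- Occurrences of 2--13 in which the `2` is a letter of `u` and the `13` is a pair of adjacent
letters of `v`: pairs of positions `(s, t)` with `v_t < u_s < v_{t+1}`. -/
def occBetween (u v : List (Fin n)) : ℕ :=
  Finset.card {p : Fin u.length × Fin v.length |
    ∃ h : (p.2 : ℕ) + 1 < v.length, v[p.2] < u[p.1] ∧ u[p.1] < v[(p.2 : ℕ) + 1]}

/-- Occurrences of 2--13 in the word `w`: pairs of positions `s < t` with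
`w_t < w_s < w_{t+1}`. -/
def occWithin (w : List (Fin n)) : ℕ :=
  Finset.card {p : Fin w.length × Fin w.length |
    p.1 < p.2 ∧ ∃ h : (p.2 : ℕ) + 1 < w.length, w[p.2] < w[p.1] ∧ w[p.1] < w[(p.2 : ℕ) + 1]}

/-- The number of cyclic occurrences of 2--13 in `π`: the occurrences between cycles, with the `2`
in an earlier cycle of the standard cycle form than the `13`, plus those within a cycle. -/
noncomputable def cyclicOcc (π : Equiv.Perm (Fin n)) : ℕ :=
  (∑ a : Fin (standardCycleForm π).length, ∑ b ∈ Finset.Ioi a,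
      occBetween (standardCycleForm π)[a] (standardCycleForm π)[b])
    + ∑ a : Fin (standardCycleForm π).length, occWithin (standardCycleForm π)[a]

end Permutations

/-- `Φ_{i,j}(n)`: the number of permutations of an `n`-element linearly ordered set with
`i` cyclic occurrences of 2--13 and `j` cycles. -/
noncomputable def Phi (i j n : ℕ) : ℕ :=
  Finset.card {π : Equiv.Perm (Fin n) | cyclicOcc π = i ∧ numCycles π = j}

end CyclicPattern

namespace CyclicPattern

/-! ### Words with flags -/

section Words

variable {α : Type*} [LinearOrder α]

/-! Erasing the parentheses of the standard cycle form is a bijection from permutations to words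
(`foataWord_injective`, `sum_foataWord`). Each cycle begins with a letter smaller than everything
before it, so a pair of adjacent letters across a cycle boundary is never the 13 of an occurrence:
cyclic occurrences become ordinary occurrences of 2--13 (`flagOcc_flatten`), and cycles become
left-to-right minima (`flagMins_flatten`).

The words are counted by deleting letters in increasing order. After a deletion, the following
letter, if any, gets a flag recording that something smaller stood just before it. The deleted
letter `t` is the 2 of exactly one occurrence for each flag to its right, and it is a left-to-right
minimum exactly when no flag is at or before it (`flagOcc_insert`, `flagMins_insert`). Hence only
the flags matter, not the letters (`wordSum_eq_fillSum`).

A deletion changes the number of flags by at most one. Summing over all flag lists with a given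
number of flags gives a recurrence (`flagSum_step_succ`) whose right side involves only sums for two
consecutive numbers of flags. These paired sums, `levelSeries`, satisfy a tridiagonal system, and
eliminating its levels from above produces the continued fraction at `y = 1`
(`X_pow_dvd_levelSeries_sub`, `levelSeries_zero_eq_F`). -/

/-- The number of letters `c > b` of a flagged word that carry a flag or are preceded by a letter
smaller than `b`; `s` tells whether the letter before the first one is smaller than `b`. -/
def straddle (b : α) : Bool → List (Bool × α) → ℕ
  | _, [] => 0
  | s, (f, c) :: L => (if b < c ∧ (f || s) = true then 1 else 0) + straddle b (decide (c < b)) L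

/-- The number of occurrences of 2--13 in a flagged word, where a flag stands for an additional
smallest letter just before the flagged one. -/
def flagOcc : List (Bool × α) → ℕ
  | [] => 0
  | (_, b) :: L => straddle b false L + flagOcc L

/-- The number of left-to-right minima smaller than `M` that precede all flags. -/
def flagMins : WithTop α → List (Bool × α) → ℕ
  | _, [] => 0
  | M, (f, b) :: L =>
      if f then 0 else if (b : WithTop α) < M then flagMins b L + 1 else flagMins M L

/-- Flag the first letter. -/
def mark : List Bool → List Bool
  | [] => []
  | _ :: B => true :: B

/-- As `t < a`, the letter `t` is never a 3 above `a`, so its own flag is irrelevant; its only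
effect is to be a smaller left neighbour, which is what a flag on the next letter records. -/
theorem straddle_insert {t a : α} (ht : t < a) (s : Bool) (b : Bool) (B₁ B₂ : List Bool)
    (u₁ u₂ : List α) (h : B₁.length = u₁.length) :
    straddle a s ((B₁ ++ b :: B₂).zip (u₁ ++ t :: u₂))
      = straddle a s ((B₁ ++ mark B₂).zip (u₁ ++ u₂)) := by
  induction u₁ generalizing s B₁ with
  | nil =>
    obtain rfl : B₁ = [] := by simpa using h
    rcases B₂ with _ | ⟨c, B₂⟩ <;> rcases u₂ with _ | ⟨v, u₂⟩ <;>
      simp [straddle, mark, ht, ht.not_gt]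
  | cons v u₁ ih =>
    obtain ⟨c, B₁, rfl⟩ := List.exists_cons_of_length_eq_add_one h
    simp [straddle, ih _ B₁ (by simpa using h)]

theorem straddle_of_forall_lt {t : α} (B : List Bool) (u : List α) (h : B.length = u.length)
    (hu : ∀ v ∈ u, t < v) : straddle t false (B.zip u) = B.count true := by
  induction u generalizing B with
  | nil =>
    obtain rfl : B = [] := by simpa using h
    simp [straddle]
  | cons v u ih =>
    obtain ⟨c, B, rfl⟩ := List.exists_cons_of_length_eq_add_one h
    have hv : t < v := hu v (by simp)
    have := ih B (by simpa using h) (fun w hw => hu w (by simp [hw]))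
    cases c <;> simp [straddle, hv, hv.not_gt, this, add_comm]

theorem flagOcc_mark (B : List Bool) (u : List α) :
    flagOcc ((mark B).zip u) = flagOcc (B.zip u) := by
  rcases B with _ | ⟨c, B⟩ <;> rcases u with _ | ⟨v, u⟩ <;> simp [mark, flagOcc]

theorem flagOcc_insert {t : α} (b : Bool) (B₁ B₂ : List Bool) (u₁ u₂ : List α)
    (h₁ : B₁.length = u₁.length) (h₂ : B₂.length = u₂.length)
    (ht₁ : ∀ v ∈ u₁, t < v) (ht₂ : ∀ v ∈ u₂, t < v) :
    flagOcc ((B₁ ++ b :: B₂).zip (u₁ ++ t :: u₂))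
      = B₂.count true + flagOcc ((B₁ ++ mark B₂).zip (u₁ ++ u₂)) := by
  induction u₁ generalizing B₁ with
  | nil =>
    obtain rfl : B₁ = [] := by simpa using h₁
    simp [flagOcc, flagOcc_mark, straddle_of_forall_lt B₂ u₂ h₂ ht₂]
  | cons v u₁ ih =>
    obtain ⟨c, B₁, rfl⟩ := List.exists_cons_of_length_eq_add_one h₁
    have h : B₁.length = u₁.length := by simpa using h₁
    simp only [List.cons_append, List.zip_cons_cons, flagOcc,
      straddle_insert (ht₁ v (by simp)) _ b B₁ B₂ u₁ u₂ h,
      ih B₁ h (fun w hw => ht₁ w (by simp [hw]))]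
    omega

theorem flagMins_eq_zero (M : WithTop α) (B : List Bool) (u : List α)
    (hu : ∀ v ∈ u, M ≤ (v : WithTop α)) : flagMins M (B.zip u) = 0 := by
  induction u generalizing B with
  | nil => simp [flagMins]
  | cons v u ih =>
    rcases B with _ | ⟨c, B⟩
    · simp [flagMins]
    · simp [flagMins, (hu v (by simp)).not_gt, ih B (fun w hw => hu w (by simp [hw]))]

theorem flagMins_mark (M : WithTop α) (B : List Bool) (u : List α) :
    flagMins M ((mark B).zip u) = 0 := by
  rcases B with _ | ⟨c, B⟩ <;> rcases u with _ | ⟨v, u⟩ <;> simp [mark, flagMins]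

/-- Nothing after the smallest letter `t` is a left-to-right minimum; on the right side the flag set
by `mark` stops the count at the same place. -/
theorem flagMins_insert {t : α} (M : WithTop α) (hM : (t : WithTop α) < M) (b : Bool)
    (B₁ B₂ : List Bool) (u₁ u₂ : List α) (h₁ : B₁.length = u₁.length)
    (ht₁ : ∀ v ∈ u₁, t < v) (ht₂ : ∀ v ∈ u₂, t < v) :
    flagMins M ((B₁ ++ b :: B₂).zip (u₁ ++ t :: u₂))
      = (if true ∈ B₁ ++ [b] then 0 else 1) + flagMins M ((B₁ ++ mark B₂).zip (u₁ ++ u₂)) := by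
  induction u₁ generalizing B₁ M with
  | nil =>
    obtain rfl : B₁ = [] := by simpa using h₁
    have := flagMins_eq_zero (t : WithTop α) B₂ u₂ (fun v hv => by exact_mod_cast (ht₂ v hv).le)
    cases b <;> simp [flagMins, flagMins_mark, hM, this]
  | cons v u₁ ih =>
    obtain ⟨c, B₁, rfl⟩ := List.exists_cons_of_length_eq_add_one h₁
    have h : B₁.length = u₁.length := by simpa using h₁
    have ht₁' : ∀ w ∈ u₁, t < w := fun w hw => ht₁ w (by simp [hw])
    have hv : (t : WithTop α) < v := by exact_mod_cast ht₁ v (by simp)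
    cases c
    · by_cases hvM : (v : WithTop α) < M
      · simp [flagMins, hvM, ih _ hv B₁ h ht₁', add_assoc]
      · simp [flagMins, hvM, ih _ hM B₁ h ht₁']
    · simp [flagMins]

end Words

/-! ### Weighted insertion of the smallest letter, and sums over flag lists -/

section Weights

variable {α : Type*} [LinearOrder α] {R : Type*} [CommRing R] (q x : R)

/-- The weight of the word `u` with flags `B`. -/
def weight (B : List Bool) (u : List α) : R :=
  q ^ flagOcc (B.zip u) * x ^ flagMins ⊤ (B.zip u)

/-- The sum of `f` over all ways to fill one position of `B` with the smallest letter, weighted;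
`s` tells whether there are flags to the left of `B`. -/
def step : Bool → (List Bool → R) → List Bool → R
  | _, _, [] => 0
  | s, f, b :: B =>
      (if (s || b) = true then 1 else x) * q ^ B.count true * f (mark B)
        + step (s || b) (fun B' => f (b :: B')) B

theorem step_zero (s : Bool) (B : List Bool) : step q x s (fun _ => 0) B = 0 := by
  induction B generalizing s with
  | nil => rfl
  | cons b B ih => simp [step, ih]

theorem step_add (s : Bool) (f g : List Bool → R) (B : List Bool) :
    step q x s (fun B' => f B' + g B') B = step q x s f B + step q x s g B := by
  induction B generalizing s f g with
  | nil => simp [step]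
  | cons b B ih => simp only [step, ih]; ring

theorem sum_step {ι : Type*} (l : List ι) (s : Bool) (f : ι → List Bool → R) (B : List Bool) :
    (l.map fun i => step q x s (f i) B).sum
      = step q x s (fun B' => (l.map fun i => f i B').sum) B := by
  induction l with
  | nil => simp [step_zero]
  | cons i l ih => simp [step_add, ih]

/-- `List.permutations'Aux` and `step` both run through the positions from the left; `g` and `f` are
kept arbitrary so that the prefix already passed can be absorbed into them. -/
theorem sum_permutations'Aux {β : Type*} (t : β) (u : List β) (s : Bool) (B : List Bool)
    (g : List β → R) (f : List Bool → R) (hB : B.length = u.length + 1)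
    (h : ∀ u₁ u₂ B₁ b B₂, u = u₁ ++ u₂ → B = B₁ ++ b :: B₂ → B₁.length = u₁.length →
      g (u₁ ++ t :: u₂) = (if (s || decide (true ∈ B₁ ++ [b])) = true then 1 else x)
        * q ^ B₂.count true * f (B₁ ++ mark B₂)) :
    ((List.permutations'Aux t u).map g).sum = step q x s f B := by
  induction u generalizing s B g f with
  | nil =>
    obtain ⟨b, rfl⟩ := List.length_eq_one_iff.1 hB
    have := h [] [] [] b [] rfl rfl rfl
    cases b <;> simpa [step] using this
  | cons v u ih =>
    obtain ⟨b, B, rfl⟩ := List.exists_cons_of_length_eq_add_one hB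
    have h0 := h [] (v :: u) [] b B rfl rfl rfl
    rw [List.permutations'Aux, List.map_cons, List.sum_cons, List.map_map, step]
    congr 1
    · cases b <;> simpa using h0
    · refine ih (s || b) B _ _ (by simpa using hB) fun u₁ u₂ B₁ c B₂ hu hB' hl => ?_
      have := h (v :: u₁) u₂ (b :: B₁) c B₂ (by simp [hu]) (by simp [hB']) (by simp [hl])
      cases b <;> cases s <;> simpa using this

/-- The generating function of the words in the letters `l` with flags `B`. -/
def wordSum (l : List α) (B : List Bool) : R := (l.permutations'.map (weight q x B)).sum

theorem wordSum_cons (t : α) (l : List α) (ht : ∀ v ∈ l, t < v) (B : List Bool)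
    (hB : B.length = l.length + 1) :
    wordSum q x (t :: l) B = step q x false (wordSum q x l) B := by
  unfold wordSum
  rw [← sum_step, List.permutations', List.map_flatMap, List.flatMap_def, List.sum_flatten,
    List.map_map]
  congr 1
  refine List.map_congr_left fun u hu => ?_
  have hperm := List.mem_permutations'.1 hu
  refine sum_permutations'Aux q x t u false B _ _ (by rw [hB, hperm.length_eq]) ?_
  rintro u₁ u₂ B₁ b B₂ rfl rfl h₁
  have h₂ : B₂.length = u₂.length := by
    have := hperm.length_eq
    simp at hB this
    omega
  have hlt : ∀ v ∈ u₁ ++ u₂, t < v := fun v hv => ht v (hperm.mem_iff.1 hv)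
  have ht₁ : ∀ v ∈ u₁, t < v := fun v hv => hlt v (by simp [hv])
  have ht₂ : ∀ v ∈ u₂, t < v := fun v hv => hlt v (by simp [hv])
  unfold weight
  rw [flagOcc_insert b B₁ B₂ u₁ u₂ h₁ h₂ ht₁ ht₂,
    flagMins_insert ⊤ (WithTop.coe_lt_top t) b B₁ B₂ u₁ u₂ h₁ ht₁ ht₂, pow_add, pow_add]
  split_ifs <;> simp_all <;> ring

/-- The sum of `f` over all lists of `m` flags exactly `h` of which are set. -/
def flagSum : ℕ → ℕ → (List Bool → R) → R
  | 0, 0, f => f []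
  | 0, _ + 1, _ => 0
  | m + 1, 0, f => flagSum m 0 fun B => f (false :: B)
  | m + 1, h + 1, f =>
      (flagSum m (h + 1) fun B => f (false :: B)) + flagSum m h fun B => f (true :: B)

theorem flagSum_add (m h : ℕ) (f g : List Bool → R) :
    flagSum m h (fun B => f B + g B) = flagSum m h f + flagSum m h g := by
  induction m generalizing h f g with
  | zero => cases h <;> simp [flagSum]
  | succ m ih =>
    cases h with
    | zero => simp only [flagSum, ih]
    | succ h => simp only [flagSum, ih]; ring

theorem flagSum_mul_pow_count (c : R) (m h : ℕ) (f : List Bool → R) :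
    flagSum m h (fun B => c * q ^ B.count true * f B) = c * q ^ h * flagSum m h f := by
  induction m generalizing h f c with
  | zero => cases h <;> simp [flagSum]
  | succ m ih =>
    cases h with
    | zero => simp [flagSum, ih]
    | succ h =>
      have (B : List Bool) : c * q ^ (B.count true + 1) * f (true :: B)
        = c * q * q ^ B.count true * f (true :: B) := by ring
      simp only [flagSum, List.count_cons, beq_self_eq_true, if_true, this, ih, beq_iff_eq,
        Bool.false_eq_true, if_false, add_zero]
      ring

theorem flagSum_zero_right (m : ℕ) (f : List Bool → R) :
    flagSum m 0 f = f (List.replicate m false) := by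
  induction m generalizing f with
  | zero => rfl
  | succ m ih => rw [flagSum, ih]; rfl

theorem qNum_succ (h : ℕ) : qNum q (h + 1) = qNum q h + q ^ h := Finset.sum_range_succ _ _

theorem qNumOne_succ (h : ℕ) : qNumOne q x (h + 1) = qNum q h + x * q ^ h := rfl

theorem flagSum_step_zero (m : ℕ) (s : Bool) (f : List Bool → R) :
    flagSum (m + 1) 0 (step q x s f)
      = (if s then 1 else x) * (flagSum m 0 f + flagSum m 1 f) := by
  induction m generalizing s f with
  | zero => cases s <;> simp [flagSum, step, mark]
  | succ m ih =>
    rw [flagSum]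
    simp only [step, flagSum_add, flagSum_mul_pow_count, Bool.or_false, ih]
    simp only [flagSum, mark]
    ring

/-- Group the terms by the flag list left after filling: the filled position was last or just before
a letter now flagged. If it was unflagged, the flag count stays or grows by one, and the possible
powers of `q` sum to `[h+2]_x`, where `x` sits on the top power because only then is no flag to the
left. If it was flagged, the count drops by one or stays, giving `[h+1]` without `x`. When `s`
holds, a flag further left turns `x` into `1`. -/
theorem flagSum_step_succ (m h : ℕ) (s : Bool) (f : List Bool → R) :
    flagSum (m + 1) (h + 1) (step q x s f)
      = qNumOne q (if s then 1 else x) (h + 2) * (flagSum m (h + 1) f + flagSum m (h + 2) f)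
        + qNum q (h + 1) * (flagSum m h f + flagSum m (h + 1) f) := by
  induction m generalizing h s f with
  | zero =>
    cases h with
    | zero => cases s <;> simp [flagSum, step, mark, qNum]
    | succ h => simp [flagSum]
  | succ m ih =>
    rw [flagSum]
    simp only [step, flagSum_add, flagSum_mul_pow_count, Bool.or_false, Bool.or_true, ih, if_true]
    -- A leading flag leaves `h` flags for the rest of the list, so `h = 0` needs the separate
    -- recurrence without flags.
    cases h with
    | zero =>
      rw [flagSum_step_zero]
      simp only [flagSum, mark, qNum_succ, qNumOne_succ, if_true]
      cases s <;> simp [qNum] <;> ring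
    | succ h =>
      rw [ih]
      simp only [flagSum, mark, qNum_succ, qNumOne_succ, if_true]
      ring

end Weights

/-! ### From the recurrence to the continued fraction -/

section Series

open PowerSeries

variable {R : Type*} [CommRing R] (q x : R)

/-- The weighted sum over all ways to fill the positions of `B` one by one. -/
def fillSum : ℕ → List Bool → R
  | 0 => fun _ => 1
  | m + 1 => step q x false (fillSum m)

theorem step_congr (s : Bool) (f g : List Bool → R) (B : List Bool)
    (h : ∀ B', B'.length + 1 = B.length → f B' = g B') : step q x s f B = step q x s g B := by
  induction B generalizing s f g with
  | nil => rfl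
  | cons b B ih =>
    rw [step, step, h (mark B) (by cases B <;> simp [mark])]
    congr 1
    exact ih _ _ _ fun B' hB' => h _ (by simpa using hB')

theorem wordSum_eq_fillSum {α : Type*} [LinearOrder α] (l : List α) (hl : l.Pairwise (· < ·))
    (B : List Bool) (hB : B.length = l.length) : wordSum q x l B = fillSum q x l.length B := by
  induction l generalizing B with
  | nil =>
    obtain rfl : B = [] := by simpa using hB
    simp [wordSum, weight, fillSum, flagOcc, flagMins]
  | cons t l ih =>
    obtain ⟨ht, hl⟩ := List.pairwise_cons.1 hl
    rw [wordSum_cons q x t l ht B (by simpa using hB), List.length_cons, fillSum]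
    exact step_congr q x _ _ _ _ fun B' hB' => ih hl B' (by simp at hB; omega)

/-- The generating function of the words at level `h`. -/
noncomputable def levelSeries (h : ℕ) : R⟦X⟧ :=
  PowerSeries.mk fun m =>
    flagSum m h (fillSum q x m) + flagSum m (h + 1) (fillSum q x m)

theorem levelSeries_zero :
    levelSeries q x 0 = 1 + X * (C (qNumOne q x 1 + qNum q 1) * levelSeries q x 0
      + C (qNumOne q x 2) * levelSeries q x 1) := by
  ext m
  cases m with
  | zero => simp [levelSeries, flagSum, fillSum]
  | succ m =>
    rw [map_add, coeff_succ_X_mul, map_add, coeff_C_mul, coeff_C_mul, coeff_one, levelSeries,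
      levelSeries, coeff_mk, coeff_mk, coeff_mk, fillSum, flagSum_step_zero, flagSum_step_succ]
    simp [qNum, qNumOne]
    ring

theorem levelSeries_succ (h : ℕ) :
    levelSeries q x (h + 1) = X * (C (qNumOne q x (h + 2) + qNum q (h + 2)) * levelSeries q x (h + 1)
      + C (qNumOne q x (h + 3)) * levelSeries q x (h + 2)
      + C (qNum q (h + 1)) * levelSeries q x h) := by
  ext m
  cases m with
  | zero => simp [levelSeries, flagSum]
  | succ m =>
    rw [coeff_succ_X_mul, map_add, map_add, coeff_C_mul, coeff_C_mul, coeff_C_mul, levelSeries,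
      levelSeries, levelSeries, coeff_mk, coeff_mk, coeff_mk, coeff_mk, fillSum,
      flagSum_step_succ, flagSum_step_succ]
    simp
    ring

theorem qNumOne_one (h : ℕ) : qNumOne q 1 (h + 1) = qNum q (h + 1) := by
  rw [qNumOne_succ, qNum_succ, one_mul]

theorem qNumTwo_one (h : ℕ) : qNumTwo q x 1 (h + 2) = qNumOne q x (h + 2) := by
  rw [qNumOne_succ, qNum_succ]
  simp [qNumTwo, qNum]

/-- The ratio of consecutive levels is `X [h+1]` times the continued fraction started at `h + 2`;
each further level of the convergent improves the approximation by one power of `X`. -/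
theorem X_pow_dvd_levelSeries_sub (N h : ℕ) :
    (X : R⟦X⟧) ^ (N + 2) ∣ levelSeries q x (h + 1)
      - X * C (qNum q (h + 1)) * convergent q x 1 N (h + 2) * levelSeries q x h := by
  induction N generalizing h with
  | zero =>
    have h1 := levelSeries_succ q x h
    have h2 := levelSeries_succ q x (h + 1)
    -- The convergent is `1`, and the remainder `X * (… L_{h+1} + … L_{h+2})` gains its second
    -- factor `X` by expanding both series once more with the recurrence.
    refine ⟨C (qNumOne q x (h + 2) + qNum q (h + 2)) *
      (C (qNumOne q x (h + 2) + qNum q (h + 2)) * levelSeries q x (h + 1)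
      + C (qNumOne q x (h + 3)) * levelSeries q x (h + 2)
      + C (qNum q (h + 1)) * levelSeries q x h) + C (qNumOne q x (h + 3)) *
      (C (qNumOne q x (h + 3) + qNum q (h + 3)) * levelSeries q x (h + 2)
      + C (qNumOne q x (h + 4)) * levelSeries q x (h + 3)
      + C (qNum q (h + 2)) * levelSeries q x (h + 1)), ?_⟩
    rw [convergent]
    linear_combination (1 + X * C (qNumOne q x (h + 2) + qNum q (h + 2))) * h1
      + X * C (qNumOne q x (h + 3)) * h2
  | succ N ih =>
    obtain ⟨e, he⟩ := ih (h + 1)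
    have h1 := levelSeries_succ q x h
    have hV := convergent_mul_denominator q x 1 N (h + 2)
    rw [qNumOne_one, qNumTwo_one, map_mul] at hV
    refine ⟨convergent q x 1 (N + 1) (h + 2) * C (qNumOne q x (h + 3)) * e, ?_⟩
    -- Replacing level `h + 2` by its approximation leaves the denominator of the next convergent
    -- times level `h + 1`; `hV` inverts it.
    linear_combination convergent q x 1 (N + 1) (h + 2) * h1
      + convergent q x 1 (N + 1) (h + 2) * X * C (qNumOne q x (h + 3)) * he
      - levelSeries q x (h + 1) * hV

theorem levelSeries_zero_eq_F : levelSeries q x 0 = F q x 1 := by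
  ext n
  rw [← coeff_convergent q x 1 n (n + 1) (Nat.le_succ n), ← sub_eq_zero, ← map_sub]
  refine X_pow_dvd_iff.1 ?_ n (show n < n + 3 by omega)
  obtain ⟨e, he⟩ := X_pow_dvd_levelSeries_sub q x n 0
  have h1 := levelSeries_zero q x
  have hV := convergent_mul_denominator q x 1 n 1
  rw [qNumOne_one, qNumTwo_one, map_mul] at hV
  refine ⟨convergent q x 1 (n + 1) 1 * C (qNumOne q x 2) * e, ?_⟩
  linear_combination convergent q x 1 (n + 1) 1 * h1
      + convergent q x 1 (n + 1) 1 * X * C (qNumOne q x 2) * he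
      - levelSeries q x 0 * hV

theorem wordSum_eq_coeff_F {α : Type*} [LinearOrder α] (n : ℕ) (l : List α)
    (hl : l.Pairwise (· < ·)) (hn : l.length = n + 1) :
    wordSum q x l (List.replicate (n + 1) false) = x * coeff n (F q x 1) := by
  rw [wordSum_eq_fillSum q x l hl _ (by simp [hn]), hn,
    ← flagSum_zero_right (n + 1) (fillSum q x (n + 1)), fillSum,
    flagSum_step_zero, ← levelSeries_zero_eq_F, levelSeries, coeff_mk]
  simp

end Series

/-! ### Words cut into blocks at their left-to-right minima -/

section StandardForm

variable {α : Type*} [LinearOrder α]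

/-- The word `u` without flags. -/
def unflagged {β : Type*} (u : List β) : List (Bool × β) := u.map (Prod.mk false)

theorem replicate_zip {β : Type*} (u : List β) :
    (List.replicate u.length false).zip u = unflagged u := by
  induction u with
  | nil => rfl
  | cons a u ih => simp_all [unflagged, List.replicate_succ]

/-- A list of words each starting with its strict minimum, the minima being decreasing, in
such a way that the minimum of each word is smaller than all letters of the previous words. -/
def IsStandard (L : List (List α)) : Prop :=
  (∀ w ∈ L, ∃ m t, w = m :: t ∧ ∀ a ∈ t, m < a) ∧
    L.Pairwise fun u v => ∀ a ∈ u, ∀ c ∈ v.head?, c < a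

theorem IsStandard.tail {w : List α} {L : List (List α)} (h : IsStandard (w :: L)) :
    IsStandard L :=
  ⟨fun v hv => h.1 v (by simp [hv]), (List.pairwise_cons.1 h.2).2⟩

theorem IsStandard.head?_flatten_lt {w : List α} {L : List (List α)} (h : IsStandard (w :: L)) :
    ∀ a ∈ w, ∀ c ∈ L.flatten.head?, c < a := by
  intro a ha c hc
  cases L with
  | nil => simp at hc
  | cons v L =>
    obtain ⟨m, t, rfl, -⟩ := h.1 v (by simp)
    exact (List.pairwise_cons.1 h.2).1 (m :: t) (by simp) a ha c (by simpa using hc)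

theorem straddle_append (b : α) (s : Bool) (u v : List α) (hv : ∀ c ∈ v.head?, c < b) :
    straddle b s (unflagged (u ++ v))
      = straddle b s (unflagged u) + straddle b false (unflagged v) := by
  induction u generalizing s with
  | nil =>
    cases v with
    | nil => simp [unflagged, straddle]
    | cons c v =>
      have : c < b := hv c (by simp)
      simp [unflagged, straddle, this.not_gt]
  | cons a u ih =>
    have := ih (decide (a < b))
    simp only [unflagged, List.cons_append, List.map_cons, straddle] at this ⊢
    rw [this, add_assoc]

theorem straddle_flatten (b : α) (L : List (List α)) (hL : ∀ v ∈ L, ∀ c ∈ v.head?, c < b) :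
    straddle b false (unflagged L.flatten)
      = (L.map fun v => straddle b false (unflagged v)).sum := by
  induction L with
  | nil => rfl
  | cons u L ih =>
    rw [List.flatten_cons, straddle_append, ih fun v hv => hL v (by simp [hv]), List.map_cons,
      List.sum_cons]
    intro c hc
    rw [List.head?_flatten] at hc
    obtain ⟨v, hv, hc⟩ := List.exists_of_findSome?_eq_some hc
    exact hL v (by simp [hv]) c hc

theorem flagOcc_append (u v : List α) (h : ∀ b ∈ u, ∀ c ∈ v.head?, c < b) :
    flagOcc (unflagged (u ++ v)) = flagOcc (unflagged u)
      + (u.map fun b => straddle b false (unflagged v)).sum + flagOcc (unflagged v) := by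
  induction u with
  | nil => simp [unflagged, flagOcc]
  | cons b u ih =>
    have h1 := ih fun a ha => h a (by simp [ha])
    have h2 := straddle_append b false u v (h b (by simp))
    simp only [unflagged, List.cons_append, List.map_cons, flagOcc, List.sum_cons] at h1 h2 ⊢
    rw [h1, h2]
    omega

theorem flagMins_append (M : WithTop α) (u v : List α) (hu : ∀ a ∈ u, M ≤ (a : WithTop α)) :
    flagMins M (unflagged (u ++ v)) = flagMins M (unflagged v) := by
  induction u with
  | nil => rfl
  | cons a u ih =>
    have := ih fun b hb => hu b (by simp [hb])
    simp only [unflagged, List.cons_append, List.map_cons, flagMins] at this ⊢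
    simpa [(hu a (by simp)).not_gt] using this

theorem flagMins_flatten (M : WithTop α) (L : List (List α)) (hL : IsStandard L)
    (hM : ∀ v ∈ L, ∀ c ∈ v.head?, (c : WithTop α) < M) :
    flagMins M (unflagged L.flatten) = L.length := by
  induction L generalizing M with
  | nil => rfl
  | cons w L ih =>
    obtain ⟨m, t, rfl, ht⟩ := hL.1 w (by simp)
    have h1 := ih m hL.tail fun v hv c hc => by
      exact_mod_cast (List.pairwise_cons.1 hL.2).1 v hv m (by simp) c hc
    have h2 := flagMins_append (m : WithTop α) t L.flatten
      fun a ha => by exact_mod_cast (ht a ha).le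
    have h3 : (m : WithTop α) < M := hM _ List.mem_cons_self m (by simp)
    rw [h1] at h2
    simp only [unflagged, List.flatten_cons, List.cons_append, List.map_cons, flagMins] at h2 ⊢
    rw [if_neg (by simp), if_pos h3, h2, List.length_cons]

/-- The blocks can be read off the word: the first one continues as long as the letters exceed its
initial letter, since the next block opens with a smaller one. -/
theorem IsStandard.eq_of_flatten_eq {L L' : List (List α)} (hL : IsStandard L)
    (hL' : IsStandard L') (h : L.flatten = L'.flatten) : L = L' := by
  induction L generalizing L' with
  | nil =>
    cases L' with
    | nil => rfl
    | cons w L' => obtain ⟨m, t, rfl, -⟩ := hL'.1 w (by simp); simp at h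
  | cons w L ih =>
    cases L' with
    | nil => obtain ⟨m, t, rfl, -⟩ := hL.1 w (by simp); simp at h
    | cons w' L' =>
      have key : ∀ {m : α} {t : List α} {K : List (List α)}, IsStandard ((m :: t) :: K) →
          (∀ a ∈ t, m < a) → (t ++ K.flatten).takeWhile (m < ·) = t := by
        intro m t K hK ht
        rw [List.takeWhile_append_of_pos (by simpa using ht)]
        have := hK.head?_flatten_lt m (by simp)
        cases hF : K.flatten with
        | nil => simp
        | cons c F => simp [((this c (by simp [hF])).not_gt)]
      obtain ⟨m, t, rfl, ht⟩ := hL.1 w (by simp)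
      obtain ⟨m', t', rfl, ht'⟩ := hL'.1 w' (by simp)
      simp only [List.flatten_cons, List.cons_append, List.cons.injEq] at h
      obtain ⟨rfl, h⟩ := h
      have htt : t = t' := by rw [← key hL ht, h, key hL' ht']
      subst htt
      rw [ih hL.tail hL'.tail (List.append_cancel_left h)]

end StandardForm

/-! ### Occurrences counted by positions agree with the recursive statistics -/

section Occurrences

variable {n : ℕ}

theorem card_straddle (b : Fin n) (s : Bool) (v : List (Fin n)) :
    straddle b s (unflagged v) = (if ∃ c ∈ v.head?, b < c ∧ s = true then 1 else 0)
      + Finset.card {t : Fin v.length |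
        ∃ h : (t : ℕ) + 1 < v.length, v[t] < b ∧ b < v[(t : ℕ) + 1]} := by
  induction v generalizing s with
  | nil => simp [unflagged, straddle]
  | cons c v ih =>
    have := ih (decide (c < b))
    simp only [unflagged, List.map_cons, straddle] at this ⊢
    simp only [List.length_cons]
    rw [this, Fin.card_filter_univ_succ]
    cases v with
    | nil => simp
    | cons d v =>
      by_cases h1 : c < b <;> by_cases h2 : b < d <;> simp [h1, h2]
      omega

theorem occBetween_eq (u v : List (Fin n)) :
    occBetween u v = (u.map fun b => straddle b false (unflagged v)).sum := by
  rw [occBetween, Finset.card_filter, ← Finset.univ_product_univ, Finset.sum_product,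
    ← Fin.sum_univ_fun_getElem]
  refine Finset.sum_congr rfl fun i _ => ?_
  rw [card_straddle, Finset.card_filter]
  simp

theorem occWithin_eq (w : List (Fin n)) : occWithin w = flagOcc (unflagged w) := by
  induction w with
  | nil => simp [occWithin, unflagged, flagOcc]
  | cons b w ih =>
    have h : flagOcc (unflagged (b :: w)) = straddle b false (unflagged w)
      + flagOcc (unflagged w) := rfl
    rw [h, ← ih, card_straddle, occWithin, occWithin, Finset.card_filter, Finset.card_filter,
      Finset.card_filter, ← Finset.univ_product_univ, Finset.sum_product,
      ← Finset.univ_product_univ, Finset.sum_product]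
    simp only [List.length_cons]
    rw [Fin.sum_univ_succ]
    congr 1
    · rw [Fin.sum_univ_succ]
      simp
    · refine Finset.sum_congr rfl fun i _ => ?_
      rw [Fin.sum_univ_succ]
      simp

theorem flagOcc_flatten (L : List (List (Fin n))) (hL : IsStandard L) :
    flagOcc (unflagged L.flatten)
      = (∑ a : Fin L.length, ∑ b ∈ Finset.Ioi a, occBetween L[a] L[b])
        + ∑ a : Fin L.length, occWithin L[a] := by
  induction L with
  | nil => simp [unflagged, flagOcc]
  | cons w L ih =>
    rw [List.flatten_cons, flagOcc_append w L.flatten hL.head?_flatten_lt, ih hL.tail]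
    simp only [List.length_cons]
    rw [Fin.sum_univ_succ, Fin.sum_univ_succ, Fin.sum_Ioi_zero]
    simp only [Fin.sum_Ioi_succ]
    have h1 : (w.map fun b => straddle b false (unflagged L.flatten)).sum
        = ∑ j : Fin L.length, occBetween w L[j] := by
      simp only [occBetween_eq]
      refine Eq.trans ?_ (Fin.sum_univ_fun_getElem L fun v =>
        (w.map fun b => straddle b false (unflagged v)).sum).symm
      simp only [← Multiset.sum_coe, ← Multiset.map_coe]
      rw [← Multiset.sum_map_sum_map]
      refine congrArg Multiset.sum (Multiset.map_congr rfl fun b hb => ?_)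
      refine straddle_flatten b L fun v hv => ?_
      exact (List.pairwise_cons.1 hL.2).1 v hv b hb
    rw [h1, ← occWithin_eq]
    simp
    omega

end Occurrences

/-! ### The bijection between permutations and words -/

section Cycles

variable {n : ℕ}

theorem minimalPeriod_pos (π : Equiv.Perm (Fin n)) (m : Fin n) :
    0 < Function.minimalPeriod π m :=
  Function.minimalPeriod_pos_of_mem_periodicPts
    (π.injective.mem_periodicPts m)

theorem mem_cycleWord {π : Equiv.Perm (Fin n)} {m k : Fin n} :
    k ∈ cycleWord π m ↔ π.SameCycle m k := by
  rw [cycleWord, List.mem_iterate]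
  constructor
  · rintro ⟨i, -, rfl⟩
    rw [← Equiv.Perm.coe_pow]
    exact Equiv.Perm.sameCycle_pow_right.2 (Equiv.Perm.SameCycle.refl _ _)
  · intro h
    obtain ⟨i, rfl⟩ := h.exists_nat_pow_eq
    refine ⟨i % Function.minimalPeriod π m, Nat.mod_lt _ (minimalPeriod_pos π m), ?_⟩
    rw [Function.iterate_mod_minimalPeriod_eq, Equiv.Perm.coe_pow]

theorem nodup_cycleWord (π : Equiv.Perm (Fin n)) (m : Fin n) : (cycleWord π m).Nodup := by
  rw [cycleWord, ← List.range_map_iterate]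
  refine List.Nodup.map_on (fun i hi j hj hij => ?_) List.nodup_range
  exact Function.iterate_injOn_Iio_minimalPeriod (List.mem_range.1 hi) (List.mem_range.1 hj) hij

theorem cycleWord_eq_cons (π : Equiv.Perm (Fin n)) (m : Fin n) : ∃ t, cycleWord π m = m :: t := by
  obtain ⟨k, hk⟩ := Nat.exists_eq_succ_of_ne_zero (minimalPeriod_pos π m).ne'
  exact ⟨_, by rw [cycleWord, hk, List.iterate]⟩

theorem mem_cycleMins {π : Equiv.Perm (Fin n)} {m : Fin n} :
    m ∈ cycleMins π ↔ ∀ k, π.SameCycle m k → m ≤ k := by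
  simp [cycleMins]

theorem isStandard_standardCycleForm (π : Equiv.Perm (Fin n)) :
    IsStandard (standardCycleForm π) := by
  constructor
  · intro w hw
    obtain ⟨m, hm, rfl⟩ := List.mem_map.1 hw
    have hm' := mem_cycleMins.1 ((Finset.mem_sort _).1 hm)
    obtain ⟨t, ht⟩ := cycleWord_eq_cons π m
    refine ⟨m, t, ht, fun a ha => lt_of_le_of_ne (hm' a (mem_cycleWord.1 (by simp [ht, ha]))) ?_⟩
    rintro rfl
    have := nodup_cycleWord π m
    rw [ht] at this
    exact (List.nodup_cons.1 this).1 ha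
  · rw [standardCycleForm, List.pairwise_map]
    refine (cycleMins π).sortedGT_sort.pairwise.imp_of_mem fun {m k} hm hk hmk a ha c hc => ?_
    obtain ⟨t, ht⟩ := cycleWord_eq_cons π k
    obtain rfl : k = c := by simpa [ht] using hc
    exact hmk.trans_le (mem_cycleMins.1 ((Finset.mem_sort _).1 hm) a (mem_cycleWord.1 ha))

theorem exists_mem_cycleMins (π : Equiv.Perm (Fin n)) (k : Fin n) :
    ∃ m ∈ cycleMins π, π.SameCycle m k := by
  classical
  obtain ⟨m, hm, hmin⟩ := Finset.exists_min_image
    ({m | π.SameCycle m k} : Finset (Fin n)) id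
    ⟨k, Finset.mem_filter.2 ⟨Finset.mem_univ k, Equiv.Perm.SameCycle.refl π k⟩⟩
  have hm' : π.SameCycle m k := by simpa using hm
  refine ⟨m, mem_cycleMins.2 fun l hl => hmin l ?_, hm'⟩
  simpa using hl.symm.trans hm'

/-- The word obtained from the standard cycle form by erasing the parentheses. -/
noncomputable def foataWord (π : Equiv.Perm (Fin n)) : List (Fin n) := (standardCycleForm π).flatten

theorem foataWord_perm (π : Equiv.Perm (Fin n)) : (foataWord π).Perm (List.finRange n) := by
  refine (List.perm_ext_iff_of_nodup ?_ (List.nodup_finRange n)).2 fun k => ?_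
  · refine List.nodup_flatten.2 ⟨?_, ?_⟩
    · intro w hw
      obtain ⟨m, -, rfl⟩ := List.mem_map.1 hw
      exact nodup_cycleWord π m
    · rw [standardCycleForm, List.pairwise_map]
      refine (cycleMins π).sortedGT_sort.pairwise.imp_of_mem fun {m k} hm hk hmk a ha hb => ?_
      have h := (mem_cycleWord.1 hb).trans (mem_cycleWord.1 ha).symm
      exact (mem_cycleMins.1 ((Finset.mem_sort _).1 hm) k h.symm).not_gt hmk
  · obtain ⟨m, hm, hmk⟩ := exists_mem_cycleMins π k
    simp only [List.mem_finRange, iff_true]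
    exact List.mem_flatten.2 ⟨cycleWord π m,
      List.mem_map.2 ⟨m, (Finset.mem_sort _).2 hm, rfl⟩, mem_cycleWord.2 hmk⟩

theorem eq_on_of_cycleWord_eq {π ρ : Equiv.Perm (Fin n)} {m : Fin n}
    (h : cycleWord π m = cycleWord ρ m) {k : Fin n} (hk : k ∈ cycleWord π m) : π k = ρ k := by
  have hlen : Function.minimalPeriod π m = Function.minimalPeriod ρ m := by
    simpa [cycleWord] using congrArg List.length h
  -- The endpoint `i = minimalPeriod` is needed for the image of the last letter, which is `m`
  -- again.
  have hit : ∀ i ≤ Function.minimalPeriod π m, π^[i] m = ρ^[i] m := by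
    intro i hi
    rcases hi.lt_or_eq with hi | rfl
    · have h1 := List.getElem?_iterate π m _ i hi
      have h2 := List.getElem?_iterate ρ m _ i (hlen ▸ hi)
      rw [cycleWord, cycleWord] at h
      rw [h, h2] at h1
      exact (Option.some.inj h1).symm
    · conv_rhs => rw [hlen]
      rw [Function.iterate_minimalPeriod, Function.iterate_minimalPeriod]
  obtain ⟨i, hi, rfl⟩ := List.mem_iterate.1 hk
  rw [← Function.iterate_succ_apply' (⇑π), hit (i + 1) hi, Function.iterate_succ_apply',
    hit i hi.le]

theorem foataWord_injective : Function.Injective (foataWord (n := n)) := by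
  intro π ρ h
  have hform := (isStandard_standardCycleForm π).eq_of_flatten_eq
    (isStandard_standardCycleForm ρ) h
  ext1 k
  obtain ⟨m, hm, hmk⟩ := exists_mem_cycleMins π k
  have hmem : cycleWord π m ∈ standardCycleForm ρ :=
    hform ▸ List.mem_map.2 ⟨m, (Finset.mem_sort _).2 hm, rfl⟩
  obtain ⟨m', -, hm'⟩ := List.mem_map.1 hmem
  obtain ⟨t, ht⟩ := cycleWord_eq_cons π m
  obtain ⟨t', ht'⟩ := cycleWord_eq_cons ρ m'
  obtain rfl : m' = m := by rw [ht, ht'] at hm'; exact (List.cons.inj hm').1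
  exact eq_on_of_cycleWord_eq hm'.symm (mem_cycleWord.2 hmk)

/-- Surjectivity onto the words comes from injectivity and the count `n!` on both sides. -/
theorem sum_foataWord {R : Type*} [AddCommMonoid R] (g : List (Fin n) → R) :
    ∑ π : Equiv.Perm (Fin n), g (foataWord π) = ((List.finRange n).permutations'.map g).sum := by
  classical
  have hnodup : (List.finRange n).permutations'.Nodup :=
    (List.permutations_perm_permutations' _).nodup_iff.1
      (List.nodup_permutations _ (List.nodup_finRange n))
  have himage : Finset.univ.image (foataWord (n := n))
      = (List.finRange n).permutations'.toFinset := by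
    refine Finset.eq_of_subset_of_card_le (fun w hw => ?_) ?_
    · obtain ⟨π, -, rfl⟩ := Finset.mem_image.1 hw
      exact List.mem_toFinset.2 (List.mem_permutations'.2 (foataWord_perm π))
    · rw [List.toFinset_card_of_nodup hnodup,
        ← (List.permutations_perm_permutations' _).length_eq, List.length_permutations,
        Finset.card_image_of_injective _ foataWord_injective, Finset.card_univ,
        Fintype.card_perm, Fintype.card_fin, List.length_finRange]
  rw [← List.sum_toFinset g hnodup, ← himage, Finset.sum_image foataWord_injective.injOn]

theorem weight_foataWord {R : Type*} [CommRing R] (q x : R) (π : Equiv.Perm (Fin n)) :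
    weight q x (List.replicate n false) (foataWord π) = q ^ cyclicOcc π * x ^ numCycles π := by
  have hlen : (foataWord π).length = n := by simpa using (foataWord_perm π).length_eq
  have hzip := replicate_zip (foataWord π)
  rw [hlen] at hzip
  rw [weight, hzip, foataWord, flagOcc_flatten _ (isStandard_standardCycleForm π),
    flagMins_flatten _ _ (isStandard_standardCycleForm π) fun _ _ _ _ => WithTop.coe_lt_top _]
  rfl

theorem numCycles_pos (π : Equiv.Perm (Fin (n + 1))) : 0 < numCycles π := by
  obtain ⟨m, hm, -⟩ := exists_mem_cycleMins π 0
  rw [numCycles, standardCycleForm, List.length_map, Finset.length_sort]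
  exact Finset.card_pos.2 ⟨m, hm⟩

theorem sum_perm_eq_coeff_F {R : Type*} [CommRing R] (q x : R) (n : ℕ) :
    ∑ π : Equiv.Perm (Fin (n + 1)), q ^ cyclicOcc π * x ^ numCycles π
      = x * PowerSeries.coeff n (F q x 1) := by
  rw [← wordSum_eq_coeff_F q x n (List.finRange (n + 1)) (List.pairwise_lt_finRange _)
    (by simp), wordSum, ← sum_foataWord]
  simp only [weight_foataWord]

end Cycles

end CyclicPattern

/-! ### Extraction of coefficients -/

theorem theorem1 :
    (∀ i n : ℕ, CyclicPattern.Phi i 0 (n + 1) = 0) ∧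
    ∀ i j n : ℕ,
      (CyclicPattern.Phi i (j + 1) (n + 1) : ℤ) =
        MvPolynomial.coeff (Finsupp.single 0 i + Finsupp.single 1 j)
          (PowerSeries.coeff n
            (CyclicPattern.F (MvPolynomial.X 0 : MvPolynomial (Fin 2) ℤ) (MvPolynomial.X 1) 1)) := by
  constructor
  · intro i n
    refine Finset.card_eq_zero.2 (Finset.filter_eq_empty_iff.2 fun π _ h => ?_)
    exact (CyclicPattern.numCycles_pos π).ne' h.2
  · intro i j n
    -- The extra `Finsupp.single 1 1` matches the factor `x` in front of `F`, which accounts for the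
    -- shift from `j` to `j + 1` cycles.
    have h := congrArg (MvPolynomial.coeff (Finsupp.single 0 i + Finsupp.single 1 j
      + Finsupp.single 1 1)) (CyclicPattern.sum_perm_eq_coeff_F
        (MvPolynomial.X 0 : MvPolynomial (Fin 2) ℤ) (MvPolynomial.X 1) n)
    rw [mul_comm, MvPolynomial.coeff_mul_X, MvPolynomial.coeff_sum] at h
    rw [← h, CyclicPattern.Phi, Finset.card_filter, Nat.cast_sum]
    refine Finset.sum_congr rfl fun π _ => ?_
    rw [MvPolynomial.X_pow_eq_monomial, MvPolynomial.X_pow_eq_monomial,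
      MvPolynomial.monomial_mul, MvPolynomial.coeff_monomial, add_assoc]
    have : (Finsupp.single (0 : Fin 2) (CyclicPattern.cyclicOcc π)
        + Finsupp.single 1 (CyclicPattern.numCycles π)
          = Finsupp.single 0 i + Finsupp.single 1 (j + 1))
        ↔ CyclicPattern.cyclicOcc π = i ∧ CyclicPattern.numCycles π = j + 1 := by
      simp [Finsupp.ext_iff, Fin.forall_fin_two]
    rw [← Finsupp.single_add, if_congr this rfl rfl]
    simp
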